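/- Let $S$ be a nonempty Borel subset of a Polish space, equipped with the relative topology and with its Borel $\sigma$-field $\mathcal{B}$. Let $X=(X_1,X_2,\ldots)$ be a sequence of $S$-valued random variables on a probability space $(\Omega,\mathcal{A},P)$. Put $\mathcal{F}_0=\{\emptyset,\Omega\}$ and $\mathcal{F}_n=\sigma(X_1,\ldots,X_n)$. For $n\ge 0$ let $\alpha_n(\cdot)=P(X_{n+1}\in\cdot\mid\mathcal{F}_n)$ be the predictive distribution (a regular version of the conditional distribution of $X_{n+1}$ given $\mathcal{F}_n$), and for $n\ge 1$ let $\mu_n=\frac1n\sum_{i=1}^n\delta_{X_i}$ be the empirical measure. For a bounded Borel function $f:S\to\mathbb{R}$ write $\alpha_n(f)=\int f\,d\alpha_n$, so that $\alpha_n(f)=E\{f(X_{n+1})\mid\mathcal{F}_n\}$ a.s., and $\mu_n(f)=\int f\,d\mu_n=\frac1n\sum_{i=1}^n f(X_i)$. **Theorem.** The following two conditions are equivalent. 1. For every bounded Borel function $f:S\to\mathbb{R}$, $\alpha_n(f)$ converges in probability as $n\to\infty$. 2. The limit $\lim_n P(X_n\in B)$ exists for every $B\in\mathcal{B}$ and,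 for every bounded continuous function $f:S\to\mathbb{R}$ and every $H\in\mathcal{A}$ with $P(H)>0$: - the limit $\lim_n E\{f(X_n)\mid H\}$ exists (where $E\{\cdot\mid H\}$ is expectation under $P(\cdot\mid H)$); - $\mu_n(f)$ converges in probability as $n\to\infty$; and - $\lim_n E\bigl\{\alpha_n(f)^2-\mu_n(f)^2\bigr\}=0$. Here "converges in probability" means convergence in probability to some real random variable. -/

import Mathlib

open MeasureTheory ProbabilityTheory Filter Topology
open scoped BoundedContinuousFunction

noncomputable section

namespace PredictiveDistributions

variable {Ω S : Type*} [MeasurableSpace Ω]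

/-- The vector `(X_1, …, X_n)` of the first `n` observations. The sequence `X_1, X_2, …` is
indexed from `0` in the code: `X i` stands for `X_{i+1}`. -/
def past (X : ℕ → Ω → S) (n : ℕ) (ω : Ω) : Fin n → S := fun i => X i ω

/-- The σ-field `F_n = σ(X_1, …, X_n)`; `F_0` is trivial. -/
abbrev pastSigma [MeasurableSpace S] (X : ℕ → Ω → S) (n : ℕ) : MeasurableSpace Ω :=
  ⨆ i : Fin n, MeasurableSpace.comap (X i) inferInstance

/-- The predictive distribution `α_n(ω, ·) = P(X_{n+1} ∈ · | F_n)(ω)`: the regular conditional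
distribution of `X_{n+1}` given `(X_1, …, X_n)`, evaluated along `(X_1(ω), …, X_n(ω))`. -/
def predictive [MeasurableSpace S] [StandardBorelSpace S] [Nonempty S]
    (P : Measure Ω) [IsFiniteMeasure P] (X : ℕ → Ω → S) (n : ℕ) (ω : Ω) : Measure S :=
  condDistrib (X n) (past X n) P (past X n ω)

/-- The empirical measure `μ_n(ω, ·) = (1/n) ∑_{i=1}^n δ_{X_i(ω)}` (the zero measure for
`n = 0`, which plays no role in limits as `n → ∞`). -/
def empirical [MeasurableSpace S] (X : ℕ → Ω → S) (n : ℕ) (ω : Ω) : Measure S :=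
  (n : ENNReal)⁻¹ • ∑ i ∈ Finset.range n, Measure.dirac (X i ω)

/-- For a random measure `β`, the real random variable `β(f) : ω ↦ ∫ f(x) β(ω, dx)`. -/
def evalAt [MeasurableSpace S] (β : Ω → Measure S) (f : S → ℝ) (ω : Ω) : ℝ :=
  ∫ x, f x ∂(β ω)

/-- `f ∈ M_b(S)`: `f` is a bounded Borel function. -/
def IsBoundedBorel [MeasurableSpace S] (f : S → ℝ) : Prop :=
  Measurable f ∧ ∃ C : ℝ, ∀ x, |f x| ≤ C

/-- The sequence `Z_n` of real random variables converges in probability to some (real) random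
variable. -/
def ConvergesInProbability (P : Measure Ω) (Z : ℕ → Ω → ℝ) : Prop :=
  ∃ Z' : Ω → ℝ, Measurable Z' ∧ TendstoInMeasure P Z atTop Z'

/-- `α_n(f)` converges in probability as `n → ∞`, for each `f ∈ M_b(S)`. -/
def PredictiveConvergence [MeasurableSpace S] [StandardBorelSpace S] [Nonempty S]
    (P : Measure Ω) [IsFiniteMeasure P] (X : ℕ → Ω → S) : Prop :=
  ∀ f : S → ℝ, IsBoundedBorel f →
    ConvergesInProbability P (fun n => evalAt (predictive P X n) f)

/-- `lim_n P(X_n ∈ B)` exists for every Borel set `B`. -/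
def MarginalConvergence [MeasurableSpace S] (P : Measure Ω) (X : ℕ → Ω → S) : Prop :=
  ∀ B : Set S, MeasurableSet B →
    ∃ l : ℝ, Tendsto (fun n => P.real (X n ⁻¹' B)) atTop (𝓝 l)

/-- Sanity check: `α_n(f) = E{f(X_{n+1}) | F_n}` almost surely for each `f ∈ M_b(S)`. -/
theorem evalAt_predictive_ae_eq [MeasurableSpace S] [StandardBorelSpace S] [Nonempty S]
    (P : Measure Ω) [IsProbabilityMeasure P] (X : ℕ → Ω → S) (hX : ∀ n, Measurable (X n))
    (n : ℕ) {f : S → ℝ} (hf : IsBoundedBorel f) :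
    evalAt (predictive P X n) f =ᵐ[P] P[fun ω => f (X n ω) | pastSigma X n] := by
  obtain ⟨hm, C, hC⟩ := hf
  have hpast : Measurable (past X n) := measurable_pi_lambda _ fun i => hX i
  have hσ : pastSigma X n = MeasurableSpace.comap (past X n) inferInstance := by
    simp only [pastSigma, MeasurableSpace.pi, MeasurableSpace.comap_iSup,
      MeasurableSpace.comap_comp]
    rfl
  have hint : Integrable (fun ω => f (X n ω)) P :=
    Integrable.of_bound (hm.comp (hX n)).aestronglyMeasurable C
      (Eventually.of_forall fun ω => by simpa using hC (X n ω))
  rw [hσ]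
  exact (condExp_ae_eq_integral_condDistrib hpast (hX n).aemeasurable
    hm.stronglyMeasurable hint).symm

end PredictiveDistributions

end

open MeasureTheory ProbabilityTheory Filter Topology
open scoped BoundedContinuousFunction

/-! Write Y_n = f(X_{n+1}), a_n = E[Y_n | F_n], and m_n for the average of Y_0, …, Y_{n-1}. For
bounded f, convergence in probability is L¹ convergence, so everything can be done in L¹ and L².

Two facts hold with no convergence assumption. By Lévy's upward theorem, E[G Y_n] - E[G a_n] → 0 for
each integrable G (`tendsto_integral_mul_sub_condExp`). By orthogonality of the differences Y_i -
a_i, m_n and the average of the a_i merge (`tendsto_integral_abs_average_sub`).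

If a_n → V, the first fact makes Y_n converge weakly to V, which gives the limits under P and under
P(· | H). The second gives m_n → V, so E a_n² and E m_n² share the limit E V².

Conversely, let f be continuous and m_n → M. The limits over events identify M as the weak limit of
Y_n, because a limit is also the Cesàro limit. Hence E[M a_n] → E M². The moment condition gives E
a_n² → E M², so E(a_n - M)² → 0 (`tendsto_condExp_of_average`).

The passage to Borel f uses convergence of the marginals: Nikodym's theorem makes the class of good
f closed under bounded pointwise limits (`hasL1Predictions_of_tendsto`), and a π-λ argument from
closed sets finishes. -/

namespace PredictiveDistributions

/-! ### Bounded random variables: convergence in probability, in L¹ and in L² -/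

section Bounded

variable {Ω : Type*} [mΩ : MeasurableSpace Ω] {P : Measure Ω}

/-- `f` is a.e. strongly measurable and a.e. bounded by `C` in absolute value. -/
structure AEBoundedBy (P : Measure Ω) (C : ℝ) (f : Ω → ℝ) : Prop where
  aestronglyMeasurable : AEStronglyMeasurable f P
  bound : ∀ᵐ ω ∂P, |f ω| ≤ C

lemma AEBoundedBy.integrable [IsFiniteMeasure P] {C : ℝ} {f : Ω → ℝ} (h : AEBoundedBy P C f) :
    Integrable f P :=
  Integrable.of_bound h.aestronglyMeasurable C h.bound

lemma AEBoundedBy.memLp [IsFiniteMeasure P] {C : ℝ} {f : Ω → ℝ} (h : AEBoundedBy P C f)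
    (p : ENNReal) : MemLp f p P :=
  MemLp.of_bound h.aestronglyMeasurable C h.bound

lemma AEBoundedBy.sub {C D : ℝ} {f g : Ω → ℝ} (hf : AEBoundedBy P C f) (hg : AEBoundedBy P D g) :
    AEBoundedBy P (C + D) (fun ω => f ω - g ω) :=
  ⟨hf.aestronglyMeasurable.sub hg.aestronglyMeasurable, by
    filter_upwards [hf.bound, hg.bound] with ω h1 h2
    exact (abs_sub _ _).trans (add_le_add h1 h2)⟩

lemma AEBoundedBy.mul {C D : ℝ} {f g : Ω → ℝ} (hf : AEBoundedBy P C f) (hg : AEBoundedBy P D g) :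
    AEBoundedBy P (C * D) (fun ω => f ω * g ω) :=
  ⟨hf.aestronglyMeasurable.mul hg.aestronglyMeasurable, by
    filter_upwards [hf.bound, hg.bound] with ω h1 h2
    rw [abs_mul]
    exact mul_le_mul h1 h2 (abs_nonneg _) ((abs_nonneg _).trans h1)⟩

lemma AEBoundedBy.sum {ι : Type*} {C : ℝ} {f : ι → Ω → ℝ} (hf : ∀ i, AEBoundedBy P C (f i))
    (s : Finset ι) : AEBoundedBy P (s.card * C) (fun ω => ∑ i ∈ s, f i ω) := by
  refine ⟨Finset.aestronglyMeasurable_fun_sum s fun i _ => (hf i).aestronglyMeasurable, ?_⟩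
  have : ∀ᵐ ω ∂P, ∀ i ∈ s, |f i ω| ≤ C :=
    (ae_ball_iff (Finset.countable_toSet s)).2 fun i _ => (hf i).bound
  filter_upwards [this] with ω h
  calc |∑ i ∈ s, f i ω| ≤ ∑ i ∈ s, |f i ω| := Finset.abs_sum_le_sum_abs _ _
    _ ≤ ∑ _i ∈ s, C := Finset.sum_le_sum h
    _ = s.card * C := by simp

lemma AEBoundedBy.average {C : ℝ} {f : ℕ → Ω → ℝ} (hC : 0 ≤ C) (hf : ∀ i, AEBoundedBy P C (f i))
    (n : ℕ) : AEBoundedBy P C (fun ω => (n : ℝ)⁻¹ * ∑ i ∈ Finset.range n, f i ω) := by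
  have h := AEBoundedBy.sum hf (Finset.range n)
  refine ⟨h.aestronglyMeasurable.const_mul _, ?_⟩
  filter_upwards [h.bound] with ω hω
  rw [abs_mul, abs_inv, Nat.abs_cast]
  rcases Nat.eq_zero_or_pos n with rfl | hn
  · simpa using hC
  · have : (0 : ℝ) < n := by exact_mod_cast hn
    rw [inv_mul_le_iff₀ this]
    simpa using hω

lemma AEBoundedBy.condExp {Ω : Type*} {m mΩ : MeasurableSpace Ω} {P : Measure Ω} {C : ℝ}
    {f : Ω → ℝ} (h : AEBoundedBy P C f) : AEBoundedBy P C (P[f | m]) :=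
  ⟨integrable_condExp.aestronglyMeasurable, ae_bdd_abs_condExp_of_ae_bdd_abs h.bound⟩

lemma AEBoundedBy.mono {C D : ℝ} {f : Ω → ℝ} (h : AEBoundedBy P C f) (hCD : C ≤ D) :
    AEBoundedBy P D f :=
  ⟨h.aestronglyMeasurable, h.bound.mono fun _ hω => hω.trans hCD⟩

lemma AEBoundedBy.integrable_mul {C : ℝ} {f g : Ω → ℝ} (h : AEBoundedBy P C f)
    (hg : Integrable g P) : Integrable (fun ω => g ω * f ω) P :=
  hg.mul_bdd h.aestronglyMeasurable h.bound

lemma tendstoInMeasure_of_tendsto_integral_abs {Z : ℕ → Ω → ℝ} {V : Ω → ℝ}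
    (hZ : ∀ n, Integrable (Z n) P) (hV : Integrable V P)
    (h : Tendsto (fun n => ∫ ω, |Z n ω - V ω| ∂P) atTop (𝓝 0)) :
    TendstoInMeasure P Z atTop V := by
  refine tendstoInMeasure_of_tendsto_eLpNorm one_ne_zero
    (fun n => (hZ n).aestronglyMeasurable) hV.aestronglyMeasurable ?_
  have := ENNReal.tendsto_ofReal h
  rw [ENNReal.ofReal_zero] at this
  refine this.congr fun n => ?_
  rw [eLpNorm_one_eq_lintegral_enorm, ← ofReal_integral_norm_eq_lintegral_enorm ((hZ n).sub hV)]
  rfl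

lemma convergesInProbability_of_tendsto_integral_abs {Z : ℕ → Ω → ℝ} {V : Ω → ℝ}
    (hZ : ∀ n, Integrable (Z n) P) (hV : Integrable V P)
    (h : Tendsto (fun n => ∫ ω, |Z n ω - V ω| ∂P) atTop (𝓝 0)) :
    ConvergesInProbability P Z :=
  ⟨hV.aestronglyMeasurable.mk V, hV.aestronglyMeasurable.stronglyMeasurable_mk.measurable,
    (tendstoInMeasure_of_tendsto_integral_abs hZ hV h).congr (fun _ => ae_eq_rfl)
      hV.aestronglyMeasurable.ae_eq_mk⟩

/-- Completeness of `L¹`, for integrable functions. -/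
lemma exists_tendsto_integral_abs_of_cauchy {Z : ℕ → Ω → ℝ} (hZ : ∀ n, Integrable (Z n) P)
    (h : ∀ ε > 0, ∃ N, ∀ m ≥ N, ∀ n ≥ N, ∫ ω, |Z m ω - Z n ω| ∂P < ε) :
    ∃ V : Ω → ℝ, Integrable V P ∧ Tendsto (fun n => ∫ ω, |Z n ω - V ω| ∂P) atTop (𝓝 0) := by
  have hd : ∀ (f g : Ω → ℝ) (hf : Integrable f P) (hg : Integrable g P),
      dist (hf.toL1 f) (hg.toL1 g) = ∫ ω, |f ω - g ω| ∂P := by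
    intro f g hf hg
    rw [dist_eq_norm, ← Integrable.toL1_sub, L1.norm_eq_integral_norm]
    refine integral_congr_ae ?_
    filter_upwards [(hf.sub hg).coeFn_toL1] with ω hω
    rw [hω]; rfl
  have hc : CauchySeq fun n => (hZ n).toL1 (Z n) := by
    rw [Metric.cauchySeq_iff]
    simpa only [hd] using h
  obtain ⟨v, hv⟩ := cauchySeq_tendsto_of_complete hc
  refine ⟨v, L1.integrable_coeFn v, ?_⟩
  rw [tendsto_iff_dist_tendsto_zero] at hv
  refine hv.congr fun n => ?_
  rw [← hd _ _ (hZ n) (L1.integrable_coeFn v), Integrable.toL1_coeFn]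

lemma AEBoundedBy.abs_integral_mul_le {C : ℝ} {f g : Ω → ℝ} (h : AEBoundedBy P C f)
    (hg : Integrable g P) : |∫ ω, g ω * f ω ∂P| ≤ C * ∫ ω, |g ω| ∂P := by
  rw [← integral_const_mul]
  refine abs_integral_le_integral_abs.trans (integral_mono_ae (h.integrable_mul hg).abs
    (hg.abs.const_mul C) ?_)
  filter_upwards [h.bound] with ω hω
  rw [abs_mul, mul_comm]
  exact mul_le_mul_of_nonneg_right hω (abs_nonneg _)

variable [IsProbabilityMeasure P]

lemma AEBoundedBy.nonneg {C : ℝ} {f : Ω → ℝ} (h : AEBoundedBy P C f) : 0 ≤ C := by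
  obtain ⟨ω, hω⟩ := h.bound.exists
  exact (abs_nonneg _).trans hω

/-- The variance of |f| is nonnegative. -/
lemma sq_integral_abs_le {C : ℝ} {f : Ω → ℝ} (h : AEBoundedBy P C f) :
    (∫ ω, |f ω| ∂P) ^ 2 ≤ ∫ ω, f ω ^ 2 ∂P := by
  have h1 := variance_nonneg |f| P
  rw [variance_eq_sub (h.memLp 2).abs] at h1
  simpa using h1

lemma tendsto_integral_abs_of_sq {C : ℕ → ℝ} {W : ℕ → Ω → ℝ} (h : ∀ n, AEBoundedBy P (C n) (W n))
    (hW : Tendsto (fun n => ∫ ω, W n ω ^ 2 ∂P) atTop (𝓝 0)) :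
    Tendsto (fun n => ∫ ω, |W n ω| ∂P) atTop (𝓝 0) := by
  have h0 : Tendsto (fun n => √(∫ ω, W n ω ^ 2 ∂P)) atTop (𝓝 0) := by
    simpa using hW.sqrt
  exact squeeze_zero (fun n => integral_nonneg fun ω => abs_nonneg _)
    (fun n => Real.le_sqrt_of_sq_le (sq_integral_abs_le (h n))) h0

/-- For bounded sequences, convergence in `L¹` implies convergence of second moments. -/
lemma tendsto_integral_sq {C : ℝ} {Z : ℕ → Ω → ℝ} {V : Ω → ℝ} (hZ : ∀ n, AEBoundedBy P C (Z n))
    (hV : AEBoundedBy P C V) (h : Tendsto (fun n => ∫ ω, |Z n ω - V ω| ∂P) atTop (𝓝 0)) :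
    Tendsto (fun n => ∫ ω, Z n ω ^ 2 ∂P) atTop (𝓝 (∫ ω, V ω ^ 2 ∂P)) := by
  rw [tendsto_iff_dist_tendsto_zero]
  have h2 : Tendsto (fun n => (C + C) * ∫ ω, |Z n ω - V ω| ∂P) atTop (𝓝 0) := by
    simpa using h.const_mul (C + C)
  refine squeeze_zero (fun n => dist_nonneg) (fun n => ?_) h2
  -- Factor Z² - V² = (Z - V)(Z + V), with the second factor bounded by 2C.
  have hs : AEBoundedBy P (C + C) (fun ω => Z n ω + V ω) :=
    ⟨(hZ n).aestronglyMeasurable.add hV.aestronglyMeasurable, by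
      filter_upwards [(hZ n).bound, hV.bound] with ω h1 h2
      exact (abs_add_le _ _).trans (add_le_add h1 h2)⟩
  rw [Real.dist_eq, ← integral_sub ((hZ n).memLp 2).integrable_sq (hV.memLp 2).integrable_sq]
  convert hs.abs_integral_mul_le ((hZ n).sub hV).integrable using 4
  ring

lemma tendsto_integral_mul {C : ℝ} {Z : ℕ → Ω → ℝ} {V G : Ω → ℝ} (hZ : ∀ n, AEBoundedBy P C (Z n))
    (hV : AEBoundedBy P C V) (hG : AEBoundedBy P C G)
    (h : Tendsto (fun n => ∫ ω, |Z n ω - V ω| ∂P) atTop (𝓝 0)) :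
    Tendsto (fun n => ∫ ω, G ω * Z n ω ∂P) atTop (𝓝 (∫ ω, G ω * V ω ∂P)) := by
  rw [tendsto_iff_dist_tendsto_zero]
  have h2 : Tendsto (fun n => C * ∫ ω, |Z n ω - V ω| ∂P) atTop (𝓝 0) := by
    simpa using h.const_mul C
  refine squeeze_zero (fun n => dist_nonneg) (fun n => ?_) h2
  rw [Real.dist_eq, ← integral_sub (hG.mul (hZ n)).integrable (hG.mul hV).integrable]
  convert hG.abs_integral_mul_le ((hZ n).sub hV).integrable using 4
  ring

/-- Convergence in probability of a uniformly bounded sequence is convergence in `L¹`. -/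
lemma aeBoundedBy_and_tendsto_of_tendstoInMeasure {C : ℝ} {Z : ℕ → Ω → ℝ} {V : Ω → ℝ}
    (hZ : ∀ n, AEBoundedBy P C (Z n)) (hV : Measurable V) (h : TendstoInMeasure P Z atTop V) :
    AEBoundedBy P C V ∧ Tendsto (fun n => ∫ ω, |Z n ω - V ω| ∂P) atTop (𝓝 0) := by
  have hb : ∀ᵐ ω ∂P, ∀ n, |Z n ω| ≤ C := ae_all_iff.2 fun n => (hZ n).bound
  have hVC : AEBoundedBy P C V := by
    refine ⟨hV.aestronglyMeasurable, ?_⟩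
    obtain ⟨ns, -, hns⟩ := h.exists_seq_tendsto_ae
    filter_upwards [hns, hb] with ω h1 h2
    exact le_of_tendsto h1.abs (Eventually.of_forall fun i => h2 _)
  -- Every subsequence has a further subsequence converging a.e., to which dominated convergence
  -- applies.
  refine ⟨hVC, tendsto_of_subseq_tendsto fun ns hns => ?_⟩
  have h' : TendstoInMeasure P (fun i => Z (ns i)) atTop V := fun ε hε => (h ε hε).comp hns
  obtain ⟨ms, -, hms⟩ := h'.exists_seq_tendsto_ae
  refine ⟨ms, ?_⟩
  have := tendsto_integral_filter_of_dominated_convergence (l := atTop) (μ := P)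
    (F := fun i ω => |Z (ns (ms i)) ω - V ω|) (f := fun _ => 0) (fun _ => C + C)
    (Eventually.of_forall fun i => ((hZ _).sub hVC).integrable.abs.aestronglyMeasurable)
    (Eventually.of_forall fun i => by
      filter_upwards [((hZ (ns (ms i))).sub hVC).bound] with ω hω
      simpa using hω)
    (integrable_const _)
    (by
      filter_upwards [hms] with ω hω
      simpa using (hω.sub_const (V ω)).abs)
  simpa using this

end Bounded

/-- Pull Z out of the conditional expectation of GZ and integrate. Applied on both sides, this makes
conditional expectation self-adjoint. -/
lemma integral_condExp_mul_of_stronglyMeasurable {Ω : Type*} {m mΩ : MeasurableSpace Ω}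
    {P : Measure Ω} [IsFiniteMeasure P] (hm : m ≤ mΩ) {G Z : Ω → ℝ} (hG : Integrable G P)
    (hZ : StronglyMeasurable[m] Z) (hGZ : Integrable (fun ω => G ω * Z ω) P) :
    ∫ ω, (P[G | m]) ω * Z ω ∂P = ∫ ω, G ω * Z ω ∂P := by
  rw [← integral_condExp hm (f := fun ω => G ω * Z ω)]
  exact integral_congr_ae (condExp_mul_of_stronglyMeasurable_right hZ hGZ hG).symm

/-! ### Bounded adapted sequences, their averages and one-step predictions -/

section Adapted

variable {Ω : Type*} [mΩ : MeasurableSpace Ω] {P : Measure Ω} {ℱ : Filtration ℕ mΩ}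
  {Y : ℕ → Ω → ℝ} {C : ℝ}

lemma aeBoundedBy_of_adapted (hY : ∀ n, StronglyMeasurable[ℱ (n + 1)] (Y n))
    (hC : ∀ n ω, |Y n ω| ≤ C) (n : ℕ) : AEBoundedBy P C (Y n) :=
  ⟨((hY n).mono (ℱ.le _)).aestronglyMeasurable, Eventually.of_forall (hC n)⟩

/-- `L¹` convergence passes to Cesàro averages. -/
lemma tendsto_integral_abs_cesaro {Z : ℕ → Ω → ℝ} {V : Ω → ℝ}
    (hZ : ∀ n, Integrable (Z n) P) (hV : Integrable V P)
    (h : Tendsto (fun n => ∫ ω, |Z n ω - V ω| ∂P) atTop (𝓝 0)) :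
    Tendsto (fun n : ℕ => ∫ ω, |(n : ℝ)⁻¹ * ∑ i ∈ Finset.range n, Z i ω - V ω| ∂P)
      atTop (𝓝 0) := by
  refine squeeze_zero' (Eventually.of_forall fun n => integral_nonneg fun ω => abs_nonneg _) ?_
    h.cesaro
  filter_upwards [eventually_gt_atTop 0] with n hn
  have hn' : (n : ℝ) ≠ 0 := by positivity
  have hi : ∀ i, Integrable (fun ω => |Z i ω - V ω|) P := fun i => ((hZ i).sub hV).abs
  rw [← integral_finsetSum _ fun i _ => hi i, ← integral_const_mul]
  refine integral_mono ?_ ((integrable_finsetSum _ fun i _ => hi i).const_mul _) fun ω => ?_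
  · exact (((integrable_finsetSum _ fun i _ => hZ i).const_mul _).sub hV).abs
  · have : (n : ℝ)⁻¹ * ∑ i ∈ Finset.range n, Z i ω - V ω
        = (n : ℝ)⁻¹ * ∑ i ∈ Finset.range n, (Z i ω - V ω) := by
      rw [Finset.sum_sub_distrib, Finset.sum_const, Finset.card_range, nsmul_eq_mul, mul_sub,
        inv_mul_cancel_left₀ hn']
    simp only [this, abs_mul, abs_inv, Nat.abs_cast]
    exact mul_le_mul_of_nonneg_left (Finset.abs_sum_le_sum_abs _ _) (by positivity)

variable [IsProbabilityMeasure P]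

/-- Against a fixed integrable weight, a bounded adapted sequence and its sequence of one-step
predictions are asymptotically indistinguishable. -/
lemma tendsto_integral_mul_sub_condExp (hY : ∀ n, StronglyMeasurable[ℱ (n + 1)] (Y n))
    (hC : ∀ n ω, |Y n ω| ≤ C) {G : Ω → ℝ} (hG : Integrable G P) :
    Tendsto (fun n => ∫ ω, G ω * Y n ω ∂P - ∫ ω, G ω * (P[Y n | ℱ n]) ω ∂P) atTop (𝓝 0) := by
  have hB := fun n => aeBoundedBy_of_adapted (P := P) hY hC n
  have hm : (⨆ n, ℱ n) ≤ mΩ := iSup_le ℱ.le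
  -- Lévy's upward theorem in L¹.
  have hL : Tendsto (fun n => ∫ ω, |(P[G | ℱ n]) ω - (P[G | ⨆ n, ℱ n]) ω| ∂P) atTop (𝓝 0) := by
    have h := (ENNReal.tendsto_toReal ENNReal.zero_ne_top).comp
      (tendsto_eLpNorm_condExp (μ := P) (ℱ := ℱ) G)
    refine h.congr fun n => ?_
    rw [Function.comp_apply, eLpNorm_one_eq_lintegral_enorm,
      ← integral_norm_eq_lintegral_enorm
        (integrable_condExp.sub integrable_condExp).aestronglyMeasurable]
    rfl
  have hL' := hL.const_mul C
  rw [mul_zero] at hL'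
  refine squeeze_zero_norm (fun n => ?_) hL'
  -- Both integrals become integrals of Y_n, against E[G | F_∞] here and, by self-adjointness,
  -- against E[G | F_n] in `e2`.
  have e1 : ∫ ω, G ω * Y n ω ∂P = ∫ ω, (P[G | ⨆ n, ℱ n]) ω * Y n ω ∂P :=
    (integral_condExp_mul_of_stronglyMeasurable hm hG ((hY n).mono (le_iSup ℱ (n + 1)))
      ((hB n).integrable_mul hG)).symm
  have e2 : ∫ ω, G ω * (P[Y n | ℱ n]) ω ∂P = ∫ ω, (P[G | ℱ n]) ω * Y n ω ∂P := by
    rw [← integral_condExp_mul_of_stronglyMeasurable (ℱ.le n) hG stronglyMeasurable_condExp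
      ((hB n).condExp.integrable_mul hG)]
    simp_rw [mul_comm ((P[G | ℱ n]) _)]
    refine integral_condExp_mul_of_stronglyMeasurable (ℱ.le n) (hB n).integrable
      stronglyMeasurable_condExp ?_
    simpa only [mul_comm] using (hB n).integrable_mul (integrable_condExp (f := G) (m := ℱ n))
  rw [e1, e2, ← integral_sub ((hB n).integrable_mul integrable_condExp)
    ((hB n).integrable_mul integrable_condExp), Real.norm_eq_abs,
    ← abs_neg, ← integral_neg]
  convert (hB n).abs_integral_mul_le (integrable_condExp (f := G) (m := ℱ n) |>.sub
    (integrable_condExp (f := G) (m := ⨆ n, ℱ n))) using 4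
  · simp only [Pi.sub_apply]
    ring
  · rfl

/-- The second moment of a sum of bounded martingale differences grows at most linearly. -/
lemma integral_sq_sum_sub_condExp_le (hY : ∀ n, StronglyMeasurable[ℱ (n + 1)] (Y n))
    (hC : ∀ n ω, |Y n ω| ≤ C) (n : ℕ) :
    ∫ ω, (∑ i ∈ Finset.range n, (Y i ω - (P[Y i | ℱ i]) ω)) ^ 2 ∂P ≤ n * (C + C) ^ 2 := by
  have hB := fun n => aeBoundedBy_of_adapted (P := P) hY hC n
  have hD : ∀ i, AEBoundedBy P (C + C) (fun ω => Y i ω - (P[Y i | ℱ i]) ω) :=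
    fun i => (hB i).sub (hB i).condExp
  induction n with
  | zero => simp
  | succ n ih =>
    have hS := AEBoundedBy.sum hD (Finset.range n)
    have hSm : StronglyMeasurable[ℱ n]
        (fun ω => ∑ i ∈ Finset.range n, (Y i ω - (P[Y i | ℱ i]) ω)) := by
      refine Finset.stronglyMeasurable_fun_sum _ fun i hi => ?_
      have hi' : i + 1 ≤ n := Finset.mem_range.1 hi
      exact ((hY i).mono (ℱ.mono hi')).sub
        (stronglyMeasurable_condExp.mono (ℱ.mono (by omega)))
    set S := fun ω => ∑ i ∈ Finset.range n, (Y i ω - (P[Y i | ℱ i]) ω) with hSdef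
    set D := fun ω => Y n ω - (P[Y n | ℱ n]) ω with hDdef
    -- The new increment is orthogonal to the F_n-measurable sum S.
    have hcross : ∫ ω, S ω * D ω ∂P = 0 := by
      have h := integral_condExp_mul_of_stronglyMeasurable (ℱ.le n) (hB n).integrable hSm
        (hS.integrable_mul (hB n).integrable)
      have : ∀ ω, S ω * D ω = Y n ω * S ω - (P[Y n | ℱ n]) ω * S ω := fun ω => by
        simp only [hDdef]; ring
      simp_rw [this]
      rw [integral_sub (hS.integrable_mul (hB n).integrable)
        (hS.integrable_mul integrable_condExp), h, sub_self]
    have hsq : ∫ ω, D ω ^ 2 ∂P ≤ (C + C) ^ 2 := by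
      have : ∫ ω, D ω ^ 2 ∂P ≤ ∫ _ω, (C + C) ^ 2 ∂P := by
        refine integral_mono_ae ((hD n).memLp 2).integrable_sq (integrable_const _) ?_
        filter_upwards [(hD n).bound] with ω hω
        exact sq_le_sq' (neg_le_of_abs_le hω) (le_of_abs_le hω)
      simpa using this
    have hexp : ∫ ω, (S ω + D ω) ^ 2 ∂P
        = ∫ ω, S ω ^ 2 ∂P + 2 * ∫ ω, S ω * D ω ∂P + ∫ ω, D ω ^ 2 ∂P := by
      have i1 := (hS.memLp 2).integrable_sq
      have i2 := ((hS.mul (hD n)).integrable).const_mul 2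
      have i3 := ((hD n).memLp 2).integrable_sq
      have i12 : Integrable (fun ω => S ω ^ 2 + 2 * (S ω * D ω)) P := i1.add i2
      rw [← integral_const_mul, ← integral_add i1 i2, ← integral_add i12 i3]
      refine integral_congr_ae (Eventually.of_forall fun ω => ?_)
      simp only [hDdef]
      ring
    simp_rw [Finset.sum_range_succ]
    calc ∫ ω, (S ω + D ω) ^ 2 ∂P = ∫ ω, S ω ^ 2 ∂P + ∫ ω, D ω ^ 2 ∂P := by
          rw [hexp, hcross]; ring
      _ ≤ n * (C + C) ^ 2 + (C + C) ^ 2 := add_le_add ih hsq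
      _ = ((n + 1 : ℕ) : ℝ) * (C + C) ^ 2 := by push_cast; ring

/-- The averages of a bounded adapted sequence and of its one-step predictions merge in `L¹`. -/
lemma tendsto_integral_abs_average_sub (hY : ∀ n, StronglyMeasurable[ℱ (n + 1)] (Y n))
    (hC : ∀ n ω, |Y n ω| ≤ C) :
    Tendsto (fun n : ℕ => ∫ ω, |(n : ℝ)⁻¹ * ∑ i ∈ Finset.range n,
      (Y i ω - (P[Y i | ℱ i]) ω)| ∂P) atTop (𝓝 0) := by
  have hB := fun n => aeBoundedBy_of_adapted (P := P) hY hC n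
  have hD : ∀ i, AEBoundedBy P (C + C) (fun ω => Y i ω - (P[Y i | ℱ i]) ω) :=
    fun i => (hB i).sub (hB i).condExp
  refine tendsto_integral_abs_of_sq
    (fun n => AEBoundedBy.average ((hD 0).nonneg) hD n) ?_
  have h0 : Tendsto (fun n : ℕ => (C + C) ^ 2 * (n : ℝ)⁻¹) atTop (𝓝 0) := by
    simpa using (tendsto_inv_atTop_nhds_zero_nat (𝕜 := ℝ)).const_mul ((C + C) ^ 2)
  refine squeeze_zero (fun n => integral_nonneg fun ω => sq_nonneg _) (fun n => ?_) h0
  simp_rw [mul_pow]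
  rw [integral_const_mul]
  calc ((n : ℝ)⁻¹) ^ 2 * _ ≤ ((n : ℝ)⁻¹) ^ 2 * (n * (C + C) ^ 2) :=
        mul_le_mul_of_nonneg_left (integral_sq_sum_sub_condExp_le hY hC n) (sq_nonneg _)
    _ = (C + C) ^ 2 * (n : ℝ)⁻¹ := by
        rcases Nat.eq_zero_or_pos n with rfl | hn
        · simp
        · have : (n : ℝ) ≠ 0 := by positivity
          field_simp

/-- If the one-step predictions converge in `L¹`, so do the averages, to the same limit. -/
lemma tendsto_average_of_tendsto_condExp (hY : ∀ n, StronglyMeasurable[ℱ (n + 1)] (Y n))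
    (hC : ∀ n ω, |Y n ω| ≤ C) {V : Ω → ℝ} (hV : AEBoundedBy P C V)
    (h : Tendsto (fun n => ∫ ω, |(P[Y n | ℱ n]) ω - V ω| ∂P) atTop (𝓝 0)) :
    Tendsto (fun n : ℕ => ∫ ω, |(n : ℝ)⁻¹ * ∑ i ∈ Finset.range n, Y i ω - V ω| ∂P)
      atTop (𝓝 0) := by
  have hB := fun n => aeBoundedBy_of_adapted (P := P) hY hC n
  have hD : ∀ i, AEBoundedBy P (C + C) (fun ω => Y i ω - (P[Y i | ℱ i]) ω) :=
    fun i => (hB i).sub (hB i).condExp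
  -- m_n - V splits into the average of the Y_i - a_i and the Cesàro error of the a_i.
  have h1 := tendsto_integral_abs_average_sub (P := P) hY hC
  have h2 := tendsto_integral_abs_cesaro (fun n => (hB n).condExp.integrable) hV.integrable h
  have h12 := h1.add h2
  rw [add_zero] at h12
  refine squeeze_zero (fun n => integral_nonneg fun ω => abs_nonneg _) (fun n => ?_) h12
  have i1 := (AEBoundedBy.average (hD 0).nonneg hD n).integrable.abs
  have i2 := ((AEBoundedBy.average (hB 0).nonneg (fun i => (hB i).condExp (m := ℱ i)) n).sub
    hV).integrable.abs
  rw [← integral_add i1 i2]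
  refine integral_mono ((AEBoundedBy.average (hB 0).nonneg hB n).sub hV).integrable.abs
    (i1.add i2) fun ω => ?_
  refine le_of_eq_of_le (congrArg abs ?_) (abs_add_le _ _)
  rw [Finset.sum_sub_distrib]
  ring

/-- If the one-step predictions converge in `L¹` to `V`, then `Y n` converges weakly to `V`. -/
lemma tendsto_integral_mul_of_tendsto_condExp (hY : ∀ n, StronglyMeasurable[ℱ (n + 1)] (Y n))
    (hC : ∀ n ω, |Y n ω| ≤ C) {V G : Ω → ℝ} (hV : AEBoundedBy P C V) {D : ℝ}
    (hG : AEBoundedBy P D G)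
    (h : Tendsto (fun n => ∫ ω, |(P[Y n | ℱ n]) ω - V ω| ∂P) atTop (𝓝 0)) :
    Tendsto (fun n => ∫ ω, G ω * Y n ω ∂P) atTop (𝓝 (∫ ω, G ω * V ω ∂P)) := by
  have hB := fun n => aeBoundedBy_of_adapted (P := P) hY hC n
  have h1 := tendsto_integral_mul_sub_condExp (P := P) hY hC hG.integrable
  have h2 := tendsto_integral_mul (C := max C D)
    (fun n => ((hB n).condExp (m := ℱ n)).mono (le_max_left C D))
    (hV.mono (le_max_left _ _)) (hG.mono (le_max_right _ _)) h
  simpa using h1.add h2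

/-- If the averages of a bounded sequence `Y` converge in `L¹` to `M` and the integrals of `Y n`
over every event converge, then `Y n` converges weakly to `M`. -/
lemma tendsto_integral_mul_of_average (hB : ∀ n, AEBoundedBy P C (Y n)) {M : Ω → ℝ}
    (hM : AEBoundedBy P C M)
    (hH : ∀ H, MeasurableSet H → ∃ l : ℝ, Tendsto (fun n => ∫ ω in H, Y n ω ∂P) atTop (𝓝 l))
    (h : Tendsto (fun n : ℕ => ∫ ω, |(n : ℝ)⁻¹ * ∑ i ∈ Finset.range n, Y i ω - M ω| ∂P)
      atTop (𝓝 0)) {G : Ω → ℝ} (hG : Integrable G P) :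
    Tendsto (fun n => ∫ ω, G ω * Y n ω ∂P) atTop (𝓝 (∫ ω, G ω * M ω ∂P)) := by
  -- The limit over H, known only to exist, must equal its Cesàro limit, which L¹ convergence of the
  -- averages computes.
  have hset : ∀ H, MeasurableSet H →
      Tendsto (fun n => ∫ ω in H, Y n ω ∂P) atTop (𝓝 (∫ ω in H, M ω ∂P)) := by
    intro H hHm
    obtain ⟨l, hl⟩ := hH H hHm
    have h1 := hl.cesaro
    have h2 : Tendsto (fun n : ℕ => (n : ℝ)⁻¹ * ∑ i ∈ Finset.range n, ∫ ω in H, Y i ω ∂P)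
        atTop (𝓝 (∫ ω in H, M ω ∂P)) := by
      rw [tendsto_iff_dist_tendsto_zero]
      refine squeeze_zero (fun n => dist_nonneg) (fun n => ?_) h
      have hA := AEBoundedBy.average (hB 0).nonneg hB n
      rw [← integral_finsetSum _ fun i _ => (hB i).integrable.integrableOn, ← integral_const_mul,
        Real.dist_eq, ← integral_sub hA.integrable.integrableOn hM.integrable.integrableOn]
      exact abs_integral_le_integral_abs.trans (setIntegral_le_integral
        (hA.sub hM).integrable.abs (Eventually.of_forall fun ω => abs_nonneg _))
    rwa [tendsto_nhds_unique h1 h2] at hl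
  refine Integrable.induction (P := fun G => Tendsto (fun n => ∫ ω, G ω * Y n ω ∂P) atTop
    (𝓝 (∫ ω, G ω * M ω ∂P))) ?_ ?_ ?_ ?_ hG
  · intro c s hs _
    have : ∀ f : Ω → ℝ, ∫ ω, s.indicator (fun _ => c) ω * f ω ∂P = c * ∫ ω in s, f ω ∂P := by
      intro f
      rw [← integral_const_mul, ← integral_indicator hs]
      congr 1
      ext ω
      by_cases h : ω ∈ s <;> simp [h]
    simp_rw [this]
    exact (hset s hs).const_mul c
  · intro f g _ hf hg h1 h2
    simp only [Pi.add_apply, add_mul]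
    rw [integral_add (hM.integrable_mul hf) (hM.integrable_mul hg)]
    exact (h1.add h2).congr fun n =>
      (integral_add ((hB n).integrable_mul hf) ((hB n).integrable_mul hg)).symm
  · refine isClosed_of_closure_subset fun g hg => ?_
    have hC0 := hM.nonneg
    simp only [Set.mem_ofPred_eq]
    rw [Metric.tendsto_atTop]
    intro ε hε
    -- Replacing g by g' costs at most C · dist g g', uniformly in n; C + 1 avoids dividing by zero.
    obtain ⟨g', hg', hd⟩ := Metric.mem_closure_iff.1 hg (ε / (3 * (C + 1))) (by positivity)
    obtain ⟨N, hN⟩ := Metric.tendsto_atTop.1 hg' (ε / 3) (by positivity)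
    have hb : ∀ f, AEBoundedBy P C f →
        |∫ ω, g ω * f ω ∂P - ∫ ω, g' ω * f ω ∂P| < ε / 3 := by
      intro f hf
      rw [← integral_sub (hf.integrable_mul (L1.integrable_coeFn g))
        (hf.integrable_mul (L1.integrable_coeFn g'))]
      have h1 := hf.abs_integral_mul_le ((L1.integrable_coeFn g).sub (L1.integrable_coeFn g'))
      have h2 : ∫ ω, |((g : Ω → ℝ) - (g' : Ω → ℝ)) ω| ∂P = dist g g' := by
        rw [dist_eq_norm, L1.norm_eq_integral_norm]
        refine integral_congr_ae ?_
        filter_upwards [Lp.coeFn_sub g g'] with ω hω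
        rw [hω]; rfl
      rw [h2] at h1
      simp only [Pi.sub_apply, sub_mul] at h1
      refine h1.trans_lt ?_
      calc C * dist g g' ≤ C * (ε / (3 * (C + 1))) := mul_le_mul_of_nonneg_left hd.le hC0
        _ < (C + 1) * (ε / (3 * (C + 1))) := by
            apply mul_lt_mul_of_pos_right (by linarith) (by positivity)
        _ = ε / 3 := by field_simp
    refine ⟨N, fun n hn => ?_⟩
    have a1 := hb _ (hB n)
    have a2 := hb _ hM
    have a3 := hN n hn
    rw [Real.dist_eq] at a3 ⊢
    rw [abs_lt] at *
    constructor <;> linarith [a1.1, a1.2, a2.1, a2.2, a3.1, a3.2]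
  · intro f g hfg _ h1
    have : ∀ u : Ω → ℝ, ∫ ω, f ω * u ω ∂P = ∫ ω, g ω * u ω ∂P := fun u =>
      integral_congr_ae (hfg.mono fun ω hω => by simp only [hω])
    simpa only [this] using h1

/-- If the averages of a bounded adapted sequence converge in `L¹`, the integrals over every event
converge, and the second moments of predictions and averages merge, then the one-step predictions
converge in `L¹`. -/
lemma tendsto_condExp_of_average (hY : ∀ n, StronglyMeasurable[ℱ (n + 1)] (Y n))
    (hC : ∀ n ω, |Y n ω| ≤ C) {M : Ω → ℝ} (hM : AEBoundedBy P C M)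
    (hH : ∀ H, MeasurableSet H → ∃ l : ℝ, Tendsto (fun n => ∫ ω in H, Y n ω ∂P) atTop (𝓝 l))
    (h : Tendsto (fun n : ℕ => ∫ ω, |(n : ℝ)⁻¹ * ∑ i ∈ Finset.range n, Y i ω - M ω| ∂P)
      atTop (𝓝 0))
    (hsq : Tendsto (fun n : ℕ => ∫ ω, ((P[Y n | ℱ n]) ω ^ 2
      - ((n : ℝ)⁻¹ * ∑ i ∈ Finset.range n, Y i ω) ^ 2) ∂P) atTop (𝓝 0)) :
    Tendsto (fun n => ∫ ω, |(P[Y n | ℱ n]) ω - M ω| ∂P) atTop (𝓝 0) := by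
  have hB := fun n => aeBoundedBy_of_adapted (P := P) hY hC n
  have ha : ∀ n, AEBoundedBy P C (P[Y n | ℱ n]) := fun n => (hB n).condExp
  have hm := AEBoundedBy.average (hB 0).nonneg hB
  refine tendsto_integral_abs_of_sq (fun n => (ha n).sub hM) ?_
  have t1 : Tendsto (fun n => ∫ ω, (P[Y n | ℱ n]) ω ^ 2 ∂P) atTop (𝓝 (∫ ω, M ω ^ 2 ∂P)) := by
    have := hsq.add (tendsto_integral_sq hm hM h)
    rw [zero_add] at this
    refine this.congr fun n => ?_
    rw [integral_sub ((ha n).memLp 2).integrable_sq ((hm n).memLp 2).integrable_sq]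
    ring
  have t2 : Tendsto (fun n => ∫ ω, M ω * (P[Y n | ℱ n]) ω ∂P) atTop (𝓝 (∫ ω, M ω ^ 2 ∂P)) := by
    have := (tendsto_integral_mul_of_average hB hM hH h hM.integrable).sub
      (tendsto_integral_mul_sub_condExp (P := P) hY hC hM.integrable)
    simp_rw [pow_two]
    simpa using this
  -- Expand E(a_n - M)²; its limit is E M² - 2 E M² + E M² = 0.
  have t3 := (t1.sub (t2.const_mul 2)).add_const (∫ ω, M ω ^ 2 ∂P)
  convert t3 using 1
  · ext n
    have i1 := ((ha n).memLp 2).integrable_sq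
    have i2 := ((hM.mul (ha n)).integrable).const_mul 2
    have i3 := (hM.memLp 2).integrable_sq
    have i12 : Integrable (fun ω => (P[Y n | ℱ n]) ω ^ 2 - 2 * (M ω * (P[Y n | ℱ n]) ω)) P :=
      i1.sub i2
    rw [← integral_const_mul, ← integral_sub i1 i2, ← integral_add i12 i3]
    refine integral_congr_ae (Eventually.of_forall fun ω => ?_)
    ring_nf
  · congr 1
    ring

end Adapted

/-! ### Setwise convergent measures: Nikodym's theorem by a gliding hump -/

section Setwise

variable {S : Type*} [MeasurableSpace S]

/-- Nikodym's convergence theorem: a setwise convergent sequence of finite measures is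
asymptotically uniformly small along a sequence of sets that decreases to the empty set. -/
theorem exists_eventually_real_lt_of_antitone {ν : ℕ → Measure S} [∀ n, IsFiniteMeasure (ν n)]
    (hν : ∀ B, MeasurableSet B → ∃ l : ℝ, Tendsto (fun n => (ν n).real B) atTop (𝓝 l))
    {A : ℕ → Set S} (hA : ∀ k, MeasurableSet (A k)) (hanti : Antitone A) (hempty : ⋂ k, A k = ∅)
    {δ : ℝ} (hδ : 0 < δ) : ∃ k, ∀ᶠ n in atTop, (ν n).real (A k) < δ := by
  by_contra hcon
  push Not at hcon
  choose L hL using fun k => hν (A k) (hA k)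
  have hLδ : ∀ k, δ ≤ L k := fun k => by
    by_contra hlt
    have hev := (hL k).eventually_lt_const (not_le.1 hlt)
    obtain ⟨n, h1, h2⟩ := ((hcon k).and_eventually hev).exists
    linarith
  have hLanti : Antitone L := fun i j hij =>
    le_of_tendsto_of_tendsto' (hL j) (hL i) fun n => measureReal_mono (hanti hij)
  have hbdd : BddBelow (Set.range L) := ⟨δ, by rintro _ ⟨k, rfl⟩; exact hLδ k⟩
  obtain ⟨d, hd⟩ : ∃ d, d = ⨅ k, L k := ⟨_, rfl⟩
  have hdL : ∀ k, d ≤ L k := fun k => hd ▸ ciInf_le hbdd k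
  have hδd : δ ≤ d := hd ▸ le_ciInf hLδ
  -- The contradiction will be d - 2η ≤ 4η, so any positive η below d/6 would do.
  obtain ⟨η, hη⟩ : ∃ η, η = d / 10 := ⟨_, rfl⟩
  have hη0 : 0 < η := by linarith
  obtain ⟨k₀, hk₀⟩ : ∃ k, L k < d + η := exists_lt_of_ciInf_lt (by rw [← hd]; linarith)
  have hν0 : ∀ n, Tendsto (fun k => (ν n).real (A k)) atTop (𝓝 0) := fun n => by
    have h := tendsto_measure_iInter_atTop (μ := ν n) (fun k => (hA k).nullMeasurableSet) hanti
      ⟨0, measure_ne_top _ _⟩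
    rw [hempty, measure_empty] at h
    exact (ENNReal.tendsto_toReal ENNReal.zero_ne_top).comp h
  -- each step picks a later measure `q.2` that charges `A p.1 \ A q.1` and little else of `A k₀`
  have hstep : ∀ p : ℕ × ℕ, ∃ q : ℕ × ℕ, p.1 < q.1 ∧ p.2 < q.2 ∧
      d - η < (ν q.2).real (A p.1) ∧ (ν q.2).real (A k₀) < d + 2 * η ∧
      (ν q.2).real (A q.1) < η := by
    rintro ⟨k, n⟩
    have e1 := (hL k).eventually_const_lt (show d - η < L k by linarith [hdL k])
    have e2 := (hL k₀).eventually_lt_const (show L k₀ < d + 2 * η by linarith)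
    obtain ⟨n', ⟨h1, h2⟩, h3⟩ := ((e1.and e2).and (eventually_gt_atTop n)).exists
    obtain ⟨k', h4, h5⟩ :=
      (((hν0 n').eventually_lt_const hη0).and (eventually_gt_atTop k)).exists
    exact ⟨(k', n'), h5, h3, h1, h2, h4⟩
  choose next hnext using hstep
  obtain ⟨s, hs0, hs⟩ : ∃ s : ℕ → ℕ × ℕ, s 0 = (k₀, 0) ∧ ∀ j, s (j + 1) = next (s j) :=
    ⟨fun j => Nat.rec (k₀, 0) (fun _ p => next p) j, rfl, fun j => rfl⟩
  have hs1 : StrictMono fun j => (s j).1 := strictMono_nat_of_lt_succ fun j => by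
    rw [hs]; exact (hnext (s j)).1
  have hs2 : StrictMono fun j => (s j).2 := strictMono_nat_of_lt_succ fun j => by
    rw [hs]; exact (hnext (s j)).2.1
  let D : ℕ → Set S := fun j => A (s j).1 \ A (s (j + 1)).1
  have hDm : ∀ j, MeasurableSet (D j) := fun j => (hA _).diff (hA _)
  have hDk₀ : ∀ j, D j ⊆ A k₀ := fun j => Set.sdiff_subset.trans (hanti (by
    have := hs1.monotone (Nat.zero_le j)
    simpa [hs0] using this))
  have hDdisj : ∀ i j, i < j → Disjoint (D i) (D j) := fun i j hij =>
    Set.disjoint_left.2 fun x hx hy => hx.2 (hanti (hs1.monotone hij) hy.1)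
  have hDlarge : ∀ j, d - 2 * η < (ν (s (j + 1)).2).real (D j) := fun j => by
    obtain ⟨h1, -, h3, -, h5⟩ := hnext (s j)
    simp only [← hs] at h1 h3 h5
    have h6 := measureReal_sdiff_add_inter (μ := ν (s (j + 1)).2) (s := A (s j).1)
      (t := A (s (j + 1)).1) (hA _)
    have h7 : (ν (s (j + 1)).2).real (A (s j).1 ∩ A (s (j + 1)).1)
        ≤ (ν (s (j + 1)).2).real (A (s (j + 1)).1) := measureReal_mono Set.inter_subset_right
    change d - 2 * η < (ν (s (j + 1)).2).real (A (s j).1 \ A (s (j + 1)).1)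
    linarith
  -- Along odd stages the measure sees a hump inside B, so its mass there exceeds d - 2η. Along even
  -- stages the hump lies in A k₀ but outside B, leaving B less than (d + 2η) - (d - 2η). The limit
  -- on B cannot satisfy both.
  let B : Set S := ⋃ i, D (2 * i)
  have hBm : MeasurableSet B := MeasurableSet.iUnion fun i => hDm _
  obtain ⟨l, hl⟩ := hν B hBm
  have hsub : ∀ u : ℕ → ℕ, StrictMono u → Tendsto (fun j => (ν (s (u j)).2).real B) atTop (𝓝 l) :=
    fun u hu => hl.comp (hs2.comp hu).tendsto_atTop
  have hlow : d - 2 * η ≤ l := by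
    refine ge_of_tendsto' (hsub (fun i => 2 * i + 1) fun i j hij => by
      simp only; omega) fun i => ?_
    exact (hDlarge (2 * i)).le.trans (measureReal_mono (Set.subset_iUnion (fun i => D (2 * i)) i))
  have hup : l ≤ 4 * η := by
    refine le_of_tendsto' (hsub (fun i => 2 * i + 1 + 1) fun i j hij => by
      simp only; omega) fun i => ?_
    have hdisj : Disjoint B (D (2 * i + 1)) := by
      refine Set.disjoint_iUnion_left.2 fun i' => ?_
      rcases lt_or_ge (2 * i') (2 * i + 1) with h | h
      · exact hDdisj _ _ h
      · exact (hDdisj _ _ (by omega)).symm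
    have h1 := measureReal_union (μ := ν (s (2 * i + 1 + 1)).2) hdisj (hDm _)
    have h2 : (ν (s (2 * i + 1 + 1)).2).real (B ∪ D (2 * i + 1))
        ≤ (ν (s (2 * i + 1 + 1)).2).real (A k₀) :=
      measureReal_mono (Set.union_subset (Set.iUnion_subset fun i' => hDk₀ _) (hDk₀ _))
    have h3 := hDlarge (2 * i + 1)
    have h4 := (hnext (s (2 * i + 1))).2.2.2.1
    rw [← hs] at h4
    linarith
  linarith

/-- For a setwise convergent sequence of finite measures, bounded pointwise convergence to zero
gives integrals that are asymptotically uniformly small. -/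
theorem exists_eventually_integral_abs_lt {ν : ℕ → Measure S} [∀ n, IsProbabilityMeasure (ν n)]
    (hν : ∀ B, MeasurableSet B → ∃ l : ℝ, Tendsto (fun n => (ν n).real B) atTop (𝓝 l))
    {h : ℕ → S → ℝ} {C : ℝ} (hh : ∀ k, Measurable (h k)) (hC : ∀ k x, |h k x| ≤ C)
    (h0 : ∀ x, Tendsto (fun k => h k x) atTop (𝓝 0)) {ε : ℝ} (hε : 0 < ε) :
    ∃ k, ∀ᶠ n in atTop, ∫ x, |h k x| ∂(ν n) < ε := by
  have hC0 : 0 ≤ C := (abs_nonneg _).trans (hC 0 (Classical.choice (ν 0).nonempty_of_neZero))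
  -- Taking the union over j ≥ k makes the exceptional sets decrease; pointwise convergence makes
  -- their intersection empty.
  let A : ℕ → Set S := fun k => ⋃ j ≥ k, {x | ε / 2 < |h j x|}
  have hA : ∀ k, MeasurableSet (A k) := fun k => MeasurableSet.iUnion fun j =>
    MeasurableSet.iUnion fun _ => measurableSet_lt measurable_const (hh j).abs
  have hanti : Antitone A := fun i j hij => Set.iUnion₂_mono' fun k hk =>
    ⟨k, le_trans hij hk, subset_rfl⟩
  have hempty : ⋂ k, A k = ∅ := by
    refine Set.eq_empty_of_forall_notMem fun x hx => ?_
    obtain ⟨N, hN⟩ := Metric.tendsto_atTop.1 (h0 x) (ε / 2) (by positivity)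
    obtain ⟨j, hj, hxj⟩ := Set.mem_iUnion₂.1 (Set.mem_iInter.1 hx N)
    have := hN j hj
    rw [Real.dist_eq, sub_zero] at this
    exact absurd hxj (not_lt.2 this.le)
  obtain ⟨k, hk⟩ := exists_eventually_real_lt_of_antitone hν hA hanti hempty
    (show 0 < ε / (2 * (C + 1)) by positivity)
  refine ⟨k, hk.mono fun n hn => ?_⟩
  have hle : ∀ x, |h k x| ≤ ε / 2 + (A k).indicator (fun _ => C) x := fun x => by
    by_cases hx : x ∈ A k
    · rw [Set.indicator_of_mem hx]
      linarith [hC k x]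
    · rw [Set.indicator_of_notMem hx, add_zero]
      by_contra hlt
      exact hx (Set.mem_iUnion₂.2 ⟨k, le_rfl, not_le.1 hlt⟩)
  have hi : Integrable (fun x => (A k).indicator (fun _ => C) x) (ν n) :=
    (integrable_const C).indicator (hA k)
  calc ∫ x, |h k x| ∂(ν n) ≤ ∫ x, (ε / 2 + (A k).indicator (fun _ => C) x) ∂(ν n) :=
        integral_mono (Integrable.of_bound (hh k).abs.aestronglyMeasurable C
          (Eventually.of_forall fun x => by simpa using hC k x))
          ((integrable_const _).add hi) hle
    _ = ε / 2 + (ν n).real (A k) * C := by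
        rw [integral_add (integrable_const _) hi, integral_indicator_const _ (hA k)]
        simp
    _ < ε := by
        have h1 : (ν n).real (A k) * C ≤ ε / (2 * (C + 1)) * C :=
          mul_le_mul_of_nonneg_right hn.le hC0
        have h2 : ε / (2 * (C + 1)) * C < ε / (2 * (C + 1)) * (C + 1) :=
          mul_lt_mul_of_pos_left (by linarith) (by positivity)
        have h3 : ε / (2 * (C + 1)) * (C + 1) = ε / 2 := by field_simp
        linarith

end Setwise

/-! ### From continuous to bounded Borel test functions -/

section Extension

variable {Ω S : Type*} [mΩ : MeasurableSpace Ω] [MeasurableSpace S]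

/-- The filtration generated by the past of `X`, as in `pastSigma`. -/
def pastFiltration (X : ℕ → Ω → S) (hX : ∀ n, Measurable (X n)) : Filtration ℕ mΩ where
  seq n := pastSigma X n
  mono' _ n hmn := iSup_le fun i =>
    le_iSup (fun j : Fin n => MeasurableSpace.comap (X j) inferInstance) (Fin.castLE hmn i)
  le' _ := iSup_le fun i => (hX i).comap_le

lemma measurable_pastFiltration_succ {X : ℕ → Ω → S} (hX : ∀ n, Measurable (X n)) (n : ℕ) :
    Measurable[pastFiltration X hX (n + 1)] (X n) :=
  (comap_measurable (X n)).mono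
    (le_iSup (fun j : Fin (n + 1) => MeasurableSpace.comap (X j) inferInstance) (Fin.last n)) le_rfl

lemma IsBoundedBorel.stronglyMeasurable_comp {f : S → ℝ} (hf : IsBoundedBorel f)
    {X : ℕ → Ω → S} (hX : ∀ n, Measurable (X n)) (n : ℕ) :
    StronglyMeasurable[pastFiltration X hX (n + 1)] (fun ω => f (X n ω)) :=
  (hf.1.comp (measurable_pastFiltration_succ hX n)).stronglyMeasurable

lemma IsBoundedBorel.integrable_comp {f : S → ℝ} (hf : IsBoundedBorel f) {P : Measure Ω}
    [IsFiniteMeasure P] {X : Ω → S} (hX : Measurable X) : Integrable (fun ω => f (X ω)) P :=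
  Integrable.of_bound (hf.1.comp hX).aestronglyMeasurable hf.2.choose
    (Eventually.of_forall fun ω => hf.2.choose_spec (X ω))

lemma IsBoundedBorel.add {f g : S → ℝ} (hf : IsBoundedBorel f) (hg : IsBoundedBorel g) :
    IsBoundedBorel (f + g) := by
  obtain ⟨hfm, C, hC⟩ := hf
  obtain ⟨hgm, D, hD⟩ := hg
  exact ⟨hfm.add hgm, C + D, fun x => (abs_add_le _ _).trans (add_le_add (hC x) (hD x))⟩

lemma IsBoundedBorel.const_smul {f : S → ℝ} (hf : IsBoundedBorel f) (c : ℝ) :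
    IsBoundedBorel (c • f) := by
  obtain ⟨hfm, C, hC⟩ := hf
  refine ⟨hfm.const_smul c, |c| * C, fun x => ?_⟩
  simpa [abs_mul] using mul_le_mul_of_nonneg_left (hC x) (abs_nonneg c)

lemma isBoundedBorel_boundedContinuousFunction [TopologicalSpace S] [OpensMeasurableSpace S]
    (f : S →ᵇ ℝ) : IsBoundedBorel f :=
  ⟨f.continuous.measurable, ‖f‖, fun x => f.norm_coe_le_norm x⟩

/-- The bounded Borel function `f` has predictions that converge in `L¹`. -/
def HasL1Predictions (P : Measure Ω) (X : ℕ → Ω → S) (f : S → ℝ) : Prop :=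
  IsBoundedBorel f ∧ ∃ V : Ω → ℝ, Integrable V P ∧
    Tendsto (fun n => ∫ ω, |(P[fun ω => f (X n ω) | pastSigma X n]) ω - V ω| ∂P) atTop (𝓝 0)

variable {P : Measure Ω} {X : ℕ → Ω → S}

lemma HasL1Predictions.const_smul {f : S → ℝ}
    (hf : HasL1Predictions P X f) (c : ℝ) : HasL1Predictions P X (c • f) := by
  obtain ⟨hfb, V, hV, hVt⟩ := hf
  refine ⟨hfb.const_smul c, c • V, hV.smul c, ?_⟩
  have ht := hVt.const_mul |c|
  rw [mul_zero] at ht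
  refine ht.congr fun n => ?_
  rw [← integral_const_mul]
  refine integral_congr_ae ?_
  filter_upwards [condExp_smul (μ := P) c (fun ω => f (X n ω)) (pastSigma X n)] with ω hω
  have e : (P[fun ω => (c • f) (X n ω) | pastSigma X n]) ω
      = c * (P[fun ω => f (X n ω) | pastSigma X n]) ω := hω
  rw [e, ← abs_mul, Pi.smul_apply, smul_eq_mul, mul_sub]

variable [IsProbabilityMeasure P]

lemma HasL1Predictions.add (hX : ∀ n, Measurable (X n)) {f g : S → ℝ}
    (hf : HasL1Predictions P X f) (hg : HasL1Predictions P X g) :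
    HasL1Predictions P X (f + g) := by
  obtain ⟨hfb, V, hV, hVt⟩ := hf
  obtain ⟨hgb, W, hW, hWt⟩ := hg
  refine ⟨hfb.add hgb, V + W, hV.add hW, ?_⟩
  have ht := hVt.add hWt
  rw [add_zero] at ht
  refine squeeze_zero (fun n => integral_nonneg fun ω => abs_nonneg _) (fun n => ?_) ht
  have i1 : Integrable (fun ω => |(P[fun ω => f (X n ω) | pastSigma X n]) ω - V ω|) P :=
    (integrable_condExp.sub hV).abs
  have i2 : Integrable (fun ω => |(P[fun ω => g (X n ω) | pastSigma X n]) ω - W ω|) P :=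
    (integrable_condExp.sub hW).abs
  rw [← integral_add i1 i2]
  refine integral_mono_ae (integrable_condExp.sub (hV.add hW)).abs (i1.add i2) ?_
  filter_upwards [condExp_add (hfb.integrable_comp (P := P) (hX n))
    (hgb.integrable_comp (hX n)) (pastSigma X n)] with ω hω
  have e : (P[fun ω => (f + g) (X n ω) | pastSigma X n]) ω
      = (P[fun ω => f (X n ω) | pastSigma X n]) ω
        + (P[fun ω => g (X n ω) | pastSigma X n]) ω := hω
  refine le_of_eq_of_le (congrArg abs ?_) (abs_add_le _ _)
  rw [e, Pi.add_apply]
  ring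

/-- Conditional expectation contracts L¹, so closeness under the law of X_n passes to predictions.
-/
lemma integral_abs_condExp_sub_le (hX : ∀ n, Measurable (X n)) {f g : S → ℝ}
    (hf : IsBoundedBorel f) (hg : IsBoundedBorel g) (n : ℕ) :
    ∫ ω, |(P[fun ω => f (X n ω) | pastSigma X n]) ω
      - (P[fun ω => g (X n ω) | pastSigma X n]) ω| ∂P ≤ ∫ ω, |f (X n ω) - g (X n ω)| ∂P := by
  refine le_of_eq_of_le (integral_congr_ae ?_)
    (integral_abs_condExp_le (m := pastSigma X n) fun ω => f (X n ω) - g (X n ω))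
  filter_upwards [condExp_sub (hf.integrable_comp (P := P) (hX n))
    (hg.integrable_comp (hX n)) (pastSigma X n)] with ω hω
  exact congrArg abs hω.symm

/-- A function that is asymptotically approximable, in mean along the marginals, by functions with
convergent predictions has convergent predictions. -/
lemma hasL1Predictions_of_approx (hX : ∀ n, Measurable (X n)) {f : S → ℝ}
    (hf : IsBoundedBorel f)
    (h : ∀ ε > 0, ∃ g, HasL1Predictions P X g ∧
      ∀ᶠ n in atTop, ∫ ω, |f (X n ω) - g (X n ω)| ∂P < ε) :
    HasL1Predictions P X f := by
  refine ⟨hf, exists_tendsto_integral_abs_of_cauchy (fun n => integrable_condExp) fun ε hε => ?_⟩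
  -- For each index, ε/4 pays for f against g and ε/4 for g against V; two indices make ε.
  obtain ⟨g, ⟨hg, V, hV, hVt⟩, hfg⟩ := h (ε / 4) (by positivity)
  obtain ⟨N, hN⟩ := eventually_atTop.1
    (hfg.and (hVt.eventually_lt_const (show (0 : ℝ) < ε / 4 by positivity)))
  have key : ∀ n ≥ N, ∫ ω, |(P[fun ω => f (X n ω) | pastSigma X n]) ω - V ω| ∂P < ε / 2 := by
    intro n hn
    obtain ⟨h1, h2⟩ := hN n hn
    have h3 := integral_abs_condExp_sub_le (P := P) hX hf hg n
    have i1 : Integrable (fun ω => |(P[fun ω => f (X n ω) | pastSigma X n]) ω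
        - (P[fun ω => g (X n ω) | pastSigma X n]) ω|) P :=
      (integrable_condExp.sub integrable_condExp).abs
    have i2 : Integrable (fun ω => |(P[fun ω => g (X n ω) | pastSigma X n]) ω - V ω|) P :=
      (integrable_condExp.sub hV).abs
    have h4 := integral_mono (μ := P) (integrable_condExp.sub hV).abs (i1.add i2)
      fun ω => abs_sub_le ((P[fun ω => f (X n ω) | pastSigma X n]) ω)
        ((P[fun ω => g (X n ω) | pastSigma X n]) ω) (V ω)
    have h5 := integral_add i1 i2
    simp only [Pi.add_apply, Pi.sub_apply] at h4
    linarith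
  refine ⟨N, fun m hm n hn => ?_⟩
  have i1 : Integrable (fun ω => |(P[fun ω => f (X m ω) | pastSigma X m]) ω - V ω|) P :=
    (integrable_condExp.sub hV).abs
  have i2 : Integrable (fun ω => |(P[fun ω => f (X n ω) | pastSigma X n]) ω - V ω|) P :=
    (integrable_condExp.sub hV).abs
  have h4 := integral_mono (μ := P) (integrable_condExp.sub integrable_condExp).abs (i1.add i2)
    fun ω => (abs_sub_le ((P[fun ω => f (X m ω) | pastSigma X m]) ω) (V ω)
      ((P[fun ω => f (X n ω) | pastSigma X n]) ω)).trans_eq (by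
        rw [abs_sub_comm (V ω)]; rfl)
  have h5 := integral_add i1 i2
  simp only [Pi.add_apply, Pi.sub_apply] at h4
  linarith [key m hm, key n hn]

/-- Under setwise convergence of the marginals, the functions with convergent predictions are
closed under bounded pointwise limits. -/
lemma hasL1Predictions_of_tendsto (hX : ∀ n, Measurable (X n)) (hmarg : MarginalConvergence P X)
    {f : S → ℝ} {g : ℕ → S → ℝ} {C : ℝ} (hg : ∀ k, HasL1Predictions P X (g k))
    (hC : ∀ k x, |g k x| ≤ C) (hlim : ∀ x, Tendsto (fun k => g k x) atTop (𝓝 (f x))) :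
    HasL1Predictions P X f := by
  have hfC : ∀ x, |f x| ≤ C := fun x => le_of_tendsto' (hlim x).abs fun k => hC k x
  have hfm : Measurable f := measurable_of_tendsto_metrizable (fun k => (hg k).1.1)
    (tendsto_pi_nhds.2 hlim)
  refine hasL1Predictions_of_approx hX ⟨hfm, C, hfC⟩ fun ε hε => ?_
  -- Nikodym's theorem is applied to the laws of the X_n.
  have hprob : ∀ n, IsProbabilityMeasure (P.map (X n)) := fun n =>
    Measure.isProbabilityMeasure_map (hX n).aemeasurable
  have hν : ∀ B, MeasurableSet B → ∃ l : ℝ,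
      Tendsto (fun n => (P.map (X n)).real B) atTop (𝓝 l) := fun B hB => by
    simpa only [map_measureReal_apply (hX _) hB] using hmarg B hB
  obtain ⟨k, hk⟩ := exists_eventually_integral_abs_lt hν (h := fun k x => f x - g k x)
    (C := C + C) (fun k => hfm.sub (hg k).1.1)
    (fun k x => (abs_sub _ _).trans (add_le_add (hfC x) (hC k x)))
    (fun x => by simpa using (hlim x).const_sub (f x)) hε
  refine ⟨g k, hg k, hk.mono fun n hn => ?_⟩
  have hm : Measurable fun x => |f x - g k x| := (hfm.sub (hg k).1.1).abs
  rwa [integral_map (hX n).aemeasurable hm.aestronglyMeasurable] at hn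

variable [TopologicalSpace S] [TopologicalSpace.MetrizableSpace S] [BorelSpace S]

/-- Dynkin's π-λ theorem on closed sets: their indicators are bounded pointwise limits of continuous
functions, complements follow by linearity, and disjoint unions are increasing limits of finite
ones. -/
lemma hasL1Predictions_indicator (hX : ∀ n, Measurable (X n)) (hmarg : MarginalConvergence P X)
    (hcont : ∀ f : S →ᵇ ℝ, HasL1Predictions P X f) (B : Set S) (hB : MeasurableSet B) :
    HasL1Predictions P X (B.indicator fun _ => 1) := by
  let _ := TopologicalSpace.metrizableSpaceMetric S
  have hle : ∀ (B : Set S) (x : S), |B.indicator (fun _ => (1 : ℝ)) x| ≤ 1 := fun B x => by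
    by_cases hx : x ∈ B <;> simp [hx]
  have hone : HasL1Predictions P X fun _ => 1 := hcont (BoundedContinuousFunction.const S 1)
  have hzero : HasL1Predictions P X fun _ => 0 := hcont 0
  induction B, hB using MeasurableSpace.induction_on_inter
    ((BorelSpace.measurable_eq (α := S)).trans borel_eq_generateFrom_isClosed)
    isPiSystem_isClosed with
  | empty => simpa using hzero
  | basic F hF =>
    have hF : IsClosed F := hF
    let g : ℕ → S →ᵇ ℝ := fun k => BoundedContinuousFunction.mkOfBound
      ⟨fun x => (hF.apprSeq k x : ℝ), by fun_prop⟩ 1 fun x y => by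
        have h1 := HasOuterApproxClosed.apprSeq_apply_le_one hF k x
        have h2 := HasOuterApproxClosed.apprSeq_apply_le_one hF k y
        have h1' : (hF.apprSeq k x : ℝ) ≤ 1 := by exact_mod_cast h1
        have h2' : (hF.apprSeq k y : ℝ) ≤ 1 := by exact_mod_cast h2
        have h3 : (0 : ℝ) ≤ hF.apprSeq k x := NNReal.coe_nonneg _
        have h4 : (0 : ℝ) ≤ hF.apprSeq k y := NNReal.coe_nonneg _
        change |(hF.apprSeq k x : ℝ) - hF.apprSeq k y| ≤ 1
        rw [abs_le]
        constructor <;> linarith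
    refine hasL1Predictions_of_tendsto (C := 1) (g := fun k => g k) hX hmarg
      (fun k => hcont (g k)) (fun k x => ?_) fun x => ?_
    · change |(hF.apprSeq k x : ℝ)| ≤ 1
      rw [abs_of_nonneg (NNReal.coe_nonneg _)]
      exact_mod_cast HasOuterApproxClosed.apprSeq_apply_le_one hF k x
    · have h := tendsto_pi_nhds.1 (HasOuterApproxClosed.tendsto_apprSeq hF) x
      have h' := (NNReal.continuous_coe.tendsto _).comp h
      have e : ((F.indicator (fun _ => (1 : NNReal)) x : NNReal) : ℝ)
          = F.indicator (fun _ => (1 : ℝ)) x := by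
        by_cases hx : x ∈ F <;> simp [hx]
      rw [e] at h'
      exact h'
  | compl B _ ih =>
    convert hone.add hX (ih.const_smul (-1)) using 1
    ext x
    by_cases hx : x ∈ B <;> simp [hx]
  | iUnion B hdisj hBm ih =>
    let U : ℕ → Set S := fun k => ⋃ i ∈ Finset.range k, B i
    have hmono : Monotone U := fun i j hij => Set.biUnion_mono (fun a ha => by
      simp only [Finset.mem_range, SetLike.mem_coe] at ha ⊢
      omega) fun _ _ => subset_rfl
    have hU : ⋃ k, U k = ⋃ i, B i := by
      ext x
      simp only [U, Set.mem_iUnion, Finset.mem_range, exists_prop]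
      exact ⟨fun ⟨_, i, _, h⟩ => ⟨i, h⟩, fun ⟨i, h⟩ => ⟨i + 1, i, Nat.lt_succ_self i, h⟩⟩
    have hUp : ∀ k, HasL1Predictions P X ((U k).indicator fun _ => 1) := by
      intro k
      induction k with
      | zero => simpa [U] using hzero
      | succ k ihk =>
        have hd : Disjoint (U k) (B k) := Set.disjoint_iUnion₂_left.2 fun i hi =>
          hdisj (Finset.mem_range.1 hi).ne
        have e : U (k + 1) = U k ∪ B k := by
          simp only [U, Finset.range_add_one, Finset.set_biUnion_insert]
          exact Set.union_comm _ _
        rw [e]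
        exact Set.indicator_union_of_disjoint hd (fun _ => (1 : ℝ)) ▸ ihk.add hX (ih k)
    refine hasL1Predictions_of_tendsto hX hmarg hUp (fun k => hle (U k)) fun x => ?_
    rw [← hU]
    exact (hmono.tendsto_indicator U (fun _ => (1 : ℝ)) x).mono_right (pure_le_nhds _)

/-- Indicators give simple functions by linearity, and these approximate f pointwise within its
bound. -/
theorem hasL1Predictions_of_continuous (hX : ∀ n, Measurable (X n))
    (hmarg : MarginalConvergence P X) (hcont : ∀ f : S →ᵇ ℝ, HasL1Predictions P X f)
    {f : S → ℝ} (hf : IsBoundedBorel f) : HasL1Predictions P X f := by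
  have hsimple : ∀ g : SimpleFunc S ℝ, HasL1Predictions P X g := by
    intro g
    induction g using SimpleFunc.induction with
    | const c hs =>
      rename_i s
      convert (hasL1Predictions_indicator hX hmarg hcont s hs).const_smul c using 1
      ext x
      by_cases hx : x ∈ s <;> simp [hx]
    | add _ hf hg => exact hf.add hX hg
  obtain ⟨hfm, C, hC⟩ := hf
  obtain ⟨x₀⟩ : Nonempty S := P.nonempty_of_neZero.map (X 0)
  have hC0 : 0 ≤ C := (abs_nonneg _).trans (hC x₀)
  exact hasL1Predictions_of_tendsto hX hmarg
    (fun k => hsimple (hfm.stronglyMeasurable.approxBounded C k))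
    (fun k x => hfm.stronglyMeasurable.norm_approxBounded_le hC0 k x)
    fun x => hfm.stronglyMeasurable.tendsto_approxBounded_of_norm_le (hC x)

end Extension

/-! ### Random measures rewritten as conditional expectations and averages -/

section Translation

variable {Ω S : Type*} [MeasurableSpace S]

lemma evalAt_empirical (X : ℕ → Ω → S) {f : S → ℝ} (hf : IsBoundedBorel f) (n : ℕ) (ω : Ω) :
    evalAt (empirical X n) f ω = (n : ℝ)⁻¹ * ∑ i ∈ Finset.range n, f (X i ω) := by
  have hi : ∀ i ∈ Finset.range n, Integrable f (Measure.dirac (X i ω)) := fun i _ =>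
    hf.integrable_comp (X := id) measurable_id
  rw [evalAt, empirical, integral_smul_measure, integral_finsetSum_measure hi]
  simp [integral_dirac' _ _ hf.1.stronglyMeasurable]

variable [MeasurableSpace Ω]

lemma integral_cond_eq (P : Measure Ω) (H : Set Ω) (g : Ω → ℝ) :
    ∫ ω, g ω ∂(cond P H) = (P.real H)⁻¹ * ∫ ω in H, g ω ∂P := by
  rw [ProbabilityTheory.cond, integral_smul_measure, ENNReal.toReal_inv]
  rfl

variable {P : Measure Ω} [IsProbabilityMeasure P] {X : ℕ → Ω → S}

/-- An L¹ limit is a limit in probability, so it inherits the bound C almost surely. -/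
lemma HasL1Predictions.exists_bounded_limit (hX : ∀ n, Measurable (X n)) {f : S → ℝ} {C : ℝ}
    (hC : ∀ x, |f x| ≤ C) (h : HasL1Predictions P X f) :
    ∃ V : Ω → ℝ, AEBoundedBy P C V ∧ Tendsto (fun n =>
      ∫ ω, |(P[fun ω => f (X n ω) | pastSigma X n]) ω - V ω| ∂P) atTop (𝓝 0) := by
  have hB := fun n => aeBoundedBy_of_adapted (P := P) (h.1.stronglyMeasurable_comp hX)
    (fun n ω => hC (X n ω)) n
  obtain ⟨hf, V, hV, ht⟩ := h
  obtain ⟨W, hW, h'⟩ := convergesInProbability_of_tendsto_integral_abs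
      (fun n => integrable_condExp) hV ht
  exact ⟨W, aeBoundedBy_and_tendsto_of_tendstoInMeasure
    (fun n => (hB n).condExp (m := pastSigma X n)) hW h'⟩

variable [StandardBorelSpace S] [Nonempty S]

/-- The predictive integral is a version of the conditional expectation, and for bounded sequences
the two modes of convergence agree. -/
lemma convergesInProbability_evalAt_predictive_iff (hX : ∀ n, Measurable (X n)) {f : S → ℝ}
    (hf : IsBoundedBorel f) :
    ConvergesInProbability P (fun n => evalAt (predictive P X n) f) ↔ HasL1Predictions P X f := by
  have hae := fun n => evalAt_predictive_ae_eq P X hX n hf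
  obtain ⟨C, hC⟩ := hf.2
  have hB := fun n => aeBoundedBy_of_adapted (P := P) (hf.stronglyMeasurable_comp hX)
    (fun n ω => hC (X n ω)) n
  constructor
  · rintro ⟨V, hV, h⟩
    obtain ⟨h1, h2⟩ := aeBoundedBy_and_tendsto_of_tendstoInMeasure
      (fun n => (hB n).condExp (m := pastSigma X n)) hV (h.congr hae ae_eq_rfl)
    exact ⟨hf, V, h1.integrable, h2⟩
  · rintro ⟨-, V, hV, h⟩
    obtain ⟨W, hW, h'⟩ := convergesInProbability_of_tendsto_integral_abs
      (fun n => integrable_condExp) hV h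
    exact ⟨W, hW, h'.congr (fun n => (hae n).symm) ae_eq_rfl⟩

lemma integral_sq_sub_sq_evalAt (hX : ∀ n, Measurable (X n)) {f : S → ℝ} (hf : IsBoundedBorel f)
    (n : ℕ) :
    ∫ ω, ((evalAt (predictive P X n) f ω) ^ 2 - (evalAt (empirical X n) f ω) ^ 2) ∂P
      = ∫ ω, ((P[fun ω => f (X n ω) | pastSigma X n]) ω ^ 2
        - ((n : ℝ)⁻¹ * ∑ i ∈ Finset.range n, f (X i ω)) ^ 2) ∂P := by
  refine integral_congr_ae ?_
  filter_upwards [evalAt_predictive_ae_eq P X hX n hf] with ω hω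
  rw [hω, evalAt_empirical X hf]

end Translation

end PredictiveDistributions

/-! ### The equivalence -/

open PredictiveDistributions in
theorem mainTheorem4 {Ω S : Type*} [MeasurableSpace Ω]
    [TopologicalSpace S] [TopologicalSpace.MetrizableSpace S] [SecondCountableTopology S]
    [MeasurableSpace S] [BorelSpace S] [StandardBorelSpace S] [Nonempty S]
    (P : Measure Ω) [IsProbabilityMeasure P]
    (X : ℕ → Ω → S) (hX : ∀ n, Measurable (X n)) :
    PredictiveConvergence P X ↔
      MarginalConvergence P X ∧
        ∀ f : S →ᵇ ℝ, ∀ H : Set Ω, MeasurableSet H → 0 < P H →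
          (∃ l : ℝ, Tendsto (fun n => ∫ ω, f (X n ω) ∂(cond P H)) atTop (𝓝 l)) ∧
          ConvergesInProbability P (fun n => evalAt (empirical X n) f) ∧
          Tendsto (fun n => ∫ ω, ((evalAt (predictive P X n) f ω) ^ 2
            - (evalAt (empirical X n) f ω) ^ 2) ∂P) atTop (𝓝 0) := by
  constructor
  · intro hpred
    have hL : ∀ f : S → ℝ, IsBoundedBorel f → HasL1Predictions P X f := fun f hf =>
      (convergesInProbability_evalAt_predictive_iff hX hf).1 (hpred f hf)
    have hset : ∀ f : S → ℝ, IsBoundedBorel f → ∀ H, MeasurableSet H →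
        ∃ l : ℝ, Tendsto (fun n => ∫ ω in H, f (X n ω) ∂P) atTop (𝓝 l) := by
      intro f hf H hH
      obtain ⟨C, hC⟩ := hf.2
      obtain ⟨V, hV, ht⟩ := (hL f hf).exists_bounded_limit hX hC
      -- Weak convergence is tested against the indicator of H.
      have hG : AEBoundedBy P 1 (H.indicator fun _ => (1 : ℝ)) :=
        ⟨(stronglyMeasurable_const.indicator hH).aestronglyMeasurable,
          Eventually.of_forall fun ω => by by_cases h : ω ∈ H <;> simp [h]⟩
      have h := tendsto_integral_mul_of_tendsto_condExp (hf.stronglyMeasurable_comp hX)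
        (fun n ω => hC (X n ω)) hV hG ht
      refine ⟨_, h.congr fun n => ?_⟩
      rw [← integral_indicator hH]
      congr 1
      ext ω
      by_cases h : ω ∈ H <;> simp [h]
    refine ⟨fun B hB => ?_, fun f H hH hPH => ?_⟩
    · have hb : IsBoundedBorel (B.indicator fun _ => (1 : ℝ)) :=
        ⟨measurable_const.indicator hB, 1, fun x => by by_cases h : x ∈ B <;> simp [h]⟩
      obtain ⟨l, hl⟩ := hset _ hb Set.univ MeasurableSet.univ
      refine ⟨l, hl.congr fun n => ?_⟩
      rw [setIntegral_univ]
      exact integral_indicator_one (hX n hB)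
    · have hf := isBoundedBorel_boundedContinuousFunction f
      have hC : ∀ x, |f x| ≤ ‖f‖ := f.norm_coe_le_norm
      have hY := hf.stronglyMeasurable_comp hX
      have hYC : ∀ n ω, |f (X n ω)| ≤ ‖f‖ := fun n ω => hC (X n ω)
      have hB := aeBoundedBy_of_adapted (P := P) hY hYC
      obtain ⟨V, hV, ht⟩ := (hL f hf).exists_bounded_limit hX hC
      have hm := AEBoundedBy.average (hB 0).nonneg hB
      have hmt := tendsto_average_of_tendsto_condExp hY hYC hV ht
      refine ⟨?_, ?_, ?_⟩
      · obtain ⟨l, hl⟩ := hset f hf H hH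
        simp_rw [integral_cond_eq]
        exact ⟨_, hl.const_mul _⟩
      · have e : (fun n => evalAt (empirical X n) f)
            = fun (n : ℕ) ω => (n : ℝ)⁻¹ * ∑ i ∈ Finset.range n, f (X i ω) := by
          ext n ω
          exact evalAt_empirical X hf n ω
        rw [e]
        exact convergesInProbability_of_tendsto_integral_abs (fun n => (hm n).integrable)
          hV.integrable hmt
      · simp_rw [integral_sq_sub_sq_evalAt hX hf]
        have ha := fun n => (hB n).condExp (m := pastSigma X n)
        -- Both second moments tend to E V².
        have h := (tendsto_integral_sq ha hV ht).sub (tendsto_integral_sq hm hV hmt)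
        rw [sub_self] at h
        refine h.congr fun n => ?_
        rw [integral_sub ((ha n).memLp 2).integrable_sq ((hm n).memLp 2).integrable_sq]
  · rintro ⟨hmarg, hcont⟩ f hf
    refine (convergesInProbability_evalAt_predictive_iff hX hf).2
      (hasL1Predictions_of_continuous hX hmarg (fun f => ?_) hf)
    have hf := isBoundedBorel_boundedContinuousFunction f
    have hY := hf.stronglyMeasurable_comp hX
    have hYC : ∀ n ω, |f (X n ω)| ≤ ‖f‖ := fun n ω => f.norm_coe_le_norm (X n ω)
    have hB := aeBoundedBy_of_adapted (P := P) hY hYC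
    have hm := AEBoundedBy.average (hB 0).nonneg hB
    -- The last two conditions do not involve H, so H = Ω extracts them.
    obtain ⟨-, ⟨M, hMm, hM⟩, hsq⟩ := hcont f Set.univ MeasurableSet.univ (by simp)
    have e : (fun n => evalAt (empirical X n) f)
        = fun (n : ℕ) ω => (n : ℝ)⁻¹ * ∑ i ∈ Finset.range n, f (X i ω) := by
      ext n ω
      exact evalAt_empirical X hf n ω
    rw [e] at hM
    obtain ⟨hMC, hMt⟩ := aeBoundedBy_and_tendsto_of_tendstoInMeasure hm hMm hM
    simp_rw [integral_sq_sub_sq_evalAt hX hf] at hsq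
    refine ⟨hf, M, hMC.integrable,
      tendsto_condExp_of_average hY hYC hMC (fun H hH => ?_) hMt hsq⟩
    -- The hypothesis is silent on null H, where the integrals vanish anyway.
    rcases eq_or_ne (P H) 0 with h0 | h0
    · exact ⟨0, by simp [Measure.restrict_eq_zero.2 h0]⟩
    · obtain ⟨⟨l, hl⟩, -⟩ := hcont f H hH (pos_iff_ne_zero.2 h0)
      refine ⟨P.real H * l, (hl.const_mul (P.real H)).congr fun n => ?_⟩
      have : P.real H ≠ 0 := (ENNReal.toReal_pos h0 (measure_ne_top P H)).ne'
      rw [integral_cond_eq, mul_inv_cancel_left₀ this]
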